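/- Let $C$ be the space of continuous real-valued functions on $[-1,1]$ with the supremum norm $\|\cdot\|$, let $\Pi_n$ be the set of algebraic polynomials of degree $<n$, let $E_n(f)=\min_{P\in\Pi_n}\|f-P\|$, and let $\phi(x)=\sqrt{1-x^2}$. For $\gamma>0$ and $f\in C$ put $\|f\|_\gamma=\|f\|+\sup_{j\ge 0}2^{j\gamma}E_{2^j}(f)$, and let $W_\gamma=\{f\in C:\|f\|_\gamma<\infty\}$. Let $r\ge 1$ be an integer and $\gamma>r$ a real number. There is a constant $c>0$, depending only on $r$ and $\gamma$, such that for every $f\in W_\gamma$ the following holds. The function $f$ is $r$ times continuously differentiable on $(-1,1)$, and whenever $n\ge 1$ is an integer, $P\in\Pi_n$, $\epsilon>0$ and $\|f-P\|\le\epsilon$, the function $(f^{(r)}-P^{(r)})\phi^r$ on $(-1,1)$ extends to a continuous function on $[-1,1]$ and $$\|(f^{(r)}-P^{(r)})\phi^r\|\le c\,n^r\left\{\epsilon+n^{-\gamma}\|f\|_\gamma\right\},$$ where the norm on the left is the supremum norm of this extension. -/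

import Mathlib

open scoped ENNReal

/-- The space `C` of continuous real functions on `[-1, 1]`; Mathlib's norm on it is the supremum
norm. -/
abbrev CInterval : Type := C(Set.Icc (-1 : ℝ) 1, ℝ)

/-- The restriction of a polynomial to `[-1, 1]`. -/
noncomputable def polyOn (P : Polynomial ℝ) : CInterval :=
  P.toContinuousMapOn (Set.Icc (-1 : ℝ) 1)

/-- `E_n(f)`: the distance in the supremum norm from `f` to the algebraic polynomials of
degree `< n`. -/
noncomputable def bestApproxError (n : ℕ) (f : CInterval) : ℝ :=
  ⨅ P : Polynomial.degreeLT ℝ n, ‖f - polyOn P‖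

/-- `‖f‖_γ = ‖f‖ + sup_{j ≥ 0} 2^{jγ} E_{2^j}(f)`, with values in `[0, ∞]`. -/
noncomputable def gammaNorm (γ : ℝ) (f : CInterval) : ℝ≥0∞ :=
  ENNReal.ofReal ‖f‖ +
    ⨆ j : ℕ, ENNReal.ofReal ((2 : ℝ) ^ ((j : ℝ) * γ) * bestApproxError (2 ^ j) f)

/-- `W_γ`: the continuous functions on `[-1, 1]` with finite `‖f‖_γ`. -/
def WSpace (γ : ℝ) : Set CInterval := {f | gammaNorm γ f < ∞}

/-- The weight `φ(x) = √(1 - x²)`. -/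
noncomputable def chebWeight (x : ℝ) : ℝ := Real.sqrt (1 - x ^ 2)

/-- `f` as a function on `ℝ` (constant beyond the endpoints), used only to differentiate `f` at
points of the open interval `(-1, 1)`, where the choice of extension is immaterial. -/
noncomputable def toRealFun (f : CInterval) : ℝ → ℝ :=
  Set.IccExtend (show (-1 : ℝ) ≤ 1 by norm_num) f

/-! Everything rests on Bernstein's inequality `‖P^{(k)} φ^k‖ ≤ C n^k ‖P‖`
(`norm_weightedDeriv_le`). It follows from Cauchy's estimate on the circle of radius `φ(x)/n` about
`x`: this circle lies in an ellipse with foci `±1` on which a polynomial of degree at most `n` is at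
most `exp 12` times its maximum on `[-1, 1]`.

Let `Q_j` be near-best approximants of degree `< 2^j`. Then `‖Q_{j+1} - Q_j‖` is `O(2^{-jγ})`, so
consecutive `Q_j^{(r)} φ^r` differ by `O(2^{j(r-γ)})`, which is summable as `γ > r`. The limit `G`
in `C` is the extension of `f^{(r)} φ^r` (`exists_weighted_iteratedDeriv`). For `2^m` comparable to
`n`, the geometric tail bounds `G - Q_m^{(r)} φ^r`, and Bernstein's inequality bounds `(Q_m -
P)^{(r)} φ^r`. -/

/-! ### Growth of polynomials off the interval -/

open Polynomial in
/-- On the image of the punctured unit disc under the Joukowski map, a polynomial of degree `≤ n`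
bounded by `M` on `[-1, 1]` grows at most like `M |w|⁻ⁿ`. -/
theorem Polynomial.norm_pow_mul_eval_joukowski_le {P : ℂ[X]} {n : ℕ} (hP : P.natDegree ≤ n) {M : ℝ}
    (hM : ∀ x : ℝ, x ∈ Set.Icc (-1 : ℝ) 1 → ‖P.eval (x : ℂ)‖ ≤ M) {w : ℂ} (hw0 : w ≠ 0)
    (hw : ‖w‖ ≤ 1) : ‖w‖ ^ n * ‖P.eval ((w + w⁻¹) / 2)‖ ≤ M := by
  -- Multiplying by `v^n` clears the pole at `0`, so `q` is entire and the maximum principle applies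
  -- on the whole disc.
  set q : ℂ → ℂ := fun v =>
    ∑ i ∈ Finset.range (n + 1), P.coeff i * (((v ^ 2 + 1) / 2) ^ i * v ^ (n - i)) with hq
  have key : ∀ v : ℂ, v ≠ 0 → q v = v ^ n * P.eval ((v + v⁻¹) / 2) := by
    intro v hv
    rw [eval_eq_sum_range' (Nat.lt_succ_of_le hP), Finset.mul_sum]
    refine Finset.sum_congr rfl fun i hi => ?_
    have hi' : i ≤ n := Nat.lt_succ_iff.mp (Finset.mem_range.mp hi)
    have h1 : (v ^ 2 + 1) / 2 = v * ((v + v⁻¹) / 2) := by field_simp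
    have h2 : v ^ n = v ^ i * v ^ (n - i) := by rw [← pow_add, Nat.add_sub_cancel' hi']
    rw [h1, h2, mul_pow]
    ring
  have hd : Differentiable ℂ q := by
    rw [hq]
    fun_prop
  have hb : ∀ v ∈ frontier (Metric.ball (0 : ℂ) 1), ‖q v‖ ≤ M := by
    intro v hv
    rw [frontier_ball _ one_ne_zero, mem_sphere_zero_iff_norm] at hv
    have hv0 : v ≠ 0 := by
      rintro rfl
      simp at hv
    -- On the unit circle `v⁻¹` is the conjugate of `v`.
    have hre : (v + v⁻¹) / 2 = (v.re : ℂ) := by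
      rw [Complex.inv_def, Complex.normSq_eq_norm_sq, hv, Complex.re_eq_add_conj]
      simp
    rw [key v hv0, norm_mul, norm_pow, hv, one_pow, one_mul, hre]
    exact hM _ (abs_le.mp (hv ▸ Complex.abs_re_le_norm v))
  have hmem : w ∈ closure (Metric.ball (0 : ℂ) 1) := by
    rw [closure_ball _ one_ne_zero]
    simpa using hw
  have := Complex.norm_le_of_forall_mem_frontier_norm_le Metric.isBounded_ball
    hd.diffContOnCl hb hmem
  rwa [key w hw0, norm_mul, norm_pow] at this

/-- The roots of `w² - 2zw + 1` have product `1`, so one of them lies in the closed unit disc. -/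
theorem Complex.exists_joukowski_preimage (z : ℂ) :
    ∃ w : ℂ, w ≠ 0 ∧ ‖w‖ ≤ 1 ∧ (w + w⁻¹) / 2 = z := by
  obtain ⟨s, hs⟩ := IsAlgClosed.exists_pow_nat_eq (z ^ 2 - 1) (n := 2) two_pos
  have hprod : (z + s) * (z - s) = 1 := by linear_combination -hs
  have h1 : z + s ≠ 0 := left_ne_zero_of_mul_eq_one hprod
  have h2 : z - s ≠ 0 := right_ne_zero_of_mul_eq_one hprod
  have hinv : (z + s)⁻¹ = z - s := inv_eq_of_mul_eq_one_right hprod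
  have hinv' : (z - s)⁻¹ = z + s := inv_eq_of_mul_eq_one_left hprod
  rcases le_total ‖z + s‖ 1 with h | h
  · exact ⟨z + s, h1, h, by rw [hinv]; ring⟩
  · refine ⟨z - s, h2, ?_, by rw [hinv']; ring⟩
    rw [← hinv, norm_inv]
    exact inv_le_one_of_one_le₀ h

theorem Complex.norm_sub_one_add_norm_add_one_joukowski {w : ℂ} (hw : w ≠ 0) :
    ‖(w + w⁻¹) / 2 - 1‖ + ‖(w + w⁻¹) / 2 + 1‖ = ‖w‖ + ‖w‖⁻¹ := by
  have hn : ‖w‖ ≠ 0 := norm_ne_zero_iff.mpr hw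
  have h1 : (w + w⁻¹) / 2 - 1 = (w - 1) ^ 2 / (2 * w) := by field_simp; ring
  have h2 : (w + w⁻¹) / 2 + 1 = (w + 1) ^ 2 / (2 * w) := by field_simp; ring
  have h3 := parallelogram_law_with_norm ℝ w 1
  rw [h1, h2, norm_div, norm_div, norm_pow, norm_pow, norm_mul]
  simp only [Complex.norm_ofNat, norm_one] at h3 ⊢
  field_simp
  linarith

/-- The disc of radius `h √(1 - x²)` about `x ∈ [-1, 1]` lies in an ellipse with foci `±1` whose sum
of semi-axes is `1 + O(h)`; here the sum of the focal distances is bounded. -/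
theorem Complex.norm_sub_one_add_norm_add_one_le {x h : ℝ} (hx : x ^ 2 ≤ 1) (h0 : 0 ≤ h)
    (h1 : h ≤ 1) {z : ℂ} (hz : ‖z - x‖ ≤ h * Real.sqrt (1 - x ^ 2)) :
    ‖z - 1‖ + ‖z + 1‖ ≤ 2 + 11 * h ^ 2 := by
  set φ := Real.sqrt (1 - x ^ 2) with hφ
  have hφ2 : φ ^ 2 = 1 - x ^ 2 := Real.sq_sqrt (by linarith)
  have hφ0 : 0 ≤ φ := Real.sqrt_nonneg _
  have hφ1 : φ ≤ 1 := by nlinarith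
  obtain ⟨a, ha⟩ : ∃ a, z.re = x + a := ⟨z.re - x, by ring⟩
  obtain ⟨b, hb⟩ : ∃ b, z.im = b := ⟨_, rfl⟩
  have hz' : z = ⟨x + a, b⟩ := Complex.ext ha hb
  subst hz'
  have hu : a ^ 2 + b ^ 2 ≤ h ^ 2 * φ ^ 2 := by
    have h3 := pow_le_pow_left₀ (norm_nonneg _) hz 2
    rw [← Complex.normSq_eq_norm_sq, Complex.normSq_apply] at h3
    simp at h3
    nlinarith
  have hh2 : h ^ 2 * φ ^ 2 ≤ h ^ 2 := mul_le_of_le_one_right (sq_nonneg h) (by nlinarith)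
  have ha1 : |a| ≤ h * φ := abs_le_of_sq_le_sq (by nlinarith [sq_nonneg b]) (by positivity)
  have ha2 := abs_le.mp ha1
  have hx1 := abs_le.mp (abs_le_one_iff_mul_self_le_one.mpr (by nlinarith : x * x ≤ 1))
  -- The weights `1/5` and `5` keep enough of `φ²` in `hAlow` for `40 h² A + 400 h⁴` to absorb `16
  -- h² φ²` in `hprod`.
  have hxa : 2 * x * a ≤ φ ^ 2 / 5 + 5 * h ^ 2 := by
    have : x * a ≤ h * φ := by
      calc x * a ≤ |x * a| := le_abs_self _
        _ = |x| * |a| := abs_mul _ _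
        _ ≤ 1 * (h * φ) := mul_le_mul (abs_le.mpr hx1) ha1 (abs_nonneg _) zero_le_one
        _ = h * φ := one_mul _
    nlinarith [sq_nonneg (φ - 5 * h)]
  -- `A` is the real part of `1 - z²`, and `|1 - z²|` is the product of the focal distances.
  set A := φ ^ 2 - 2 * x * a - (a ^ 2 - b ^ 2) with hA
  have hAlow : 4 / 5 * φ ^ 2 - 6 * h ^ 2 ≤ A := by nlinarith [sq_nonneg b]
  have hhφ : h * φ ≤ 1 := mul_le_one₀ h1 hφ0 hφ1
  have hxa2 : (x + a) ^ 2 ≤ 4 := by nlinarith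
  have him : (2 * b * (x + a)) ^ 2 ≤ 16 * (h ^ 2 * φ ^ 2) := by
    have : b ^ 2 * (x + a) ^ 2 ≤ (h ^ 2 * φ ^ 2) * 4 :=
      mul_le_mul (by nlinarith [sq_nonneg a]) hxa2 (sq_nonneg _) (by positivity)
    nlinarith
  have hprod : ‖(⟨x + a, b⟩ : ℂ) - 1‖ * ‖(⟨x + a, b⟩ : ℂ) + 1‖ ≤ A + 20 * h ^ 2 := by
    rw [← norm_mul]
    refine le_of_sq_le_sq ?_ (by nlinarith [sq_nonneg h, sq_nonneg φ])
    rw [← Complex.normSq_eq_norm_sq, Complex.normSq_apply]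
    simp
    have e1 : (x + a - 1) * (x + a + 1) - b * b = -A := by rw [hA, hφ2]; ring
    have e2 : (x + a - 1) * b + b * (x + a + 1) = 2 * b * (x + a) := by ring
    rw [e1, e2]
    have : h ^ 2 * (4 / 5 * φ ^ 2 - 6 * h ^ 2) ≤ h ^ 2 * A :=
      mul_le_mul_of_nonneg_left hAlow (sq_nonneg h)
    nlinarith [sq_nonneg (h ^ 2), mul_nonneg (sq_nonneg h) (sq_nonneg φ)]
  have hsum : ‖(⟨x + a, b⟩ : ℂ) - 1‖ ^ 2 + ‖(⟨x + a, b⟩ : ℂ) + 1‖ ^ 2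
      = 2 * ((x + a) ^ 2 + b ^ 2 + 1) := by
    rw [← Complex.normSq_eq_norm_sq, ← Complex.normSq_eq_norm_sq, Complex.normSq_apply,
      Complex.normSq_apply]
    simp
    ring
  -- The squared sum is at most `4 + 4b² + 40h² ≤ 4 + 44h² ≤ (2 + 11h²)²`.
  refine le_of_sq_le_sq ?_ (by positivity)
  nlinarith [sq_nonneg (h ^ 2), sq_nonneg a]

/-! ### Bernstein's inequality -/

open Polynomial in
theorem Polynomial.iteratedDeriv_eval_eq {𝕜 : Type*} [NontriviallyNormedField 𝕜] (P : 𝕜[X]) (k : ℕ) :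
    iteratedDeriv k (fun z => P.eval z) = fun z => (derivative^[k] P).eval z := by
  induction k with
  | zero => simp
  | succ k ih =>
    rw [iteratedDeriv_succ, ih, Function.iterate_succ_apply']
    ext z
    exact Polynomial.deriv _

open Polynomial in
/-- Bernstein's inequality for derivatives of all orders, with a nonoptimal constant. -/
theorem Polynomial.abs_iterate_derivative_mul_sqrt_pow_le {P : ℝ[X]} {n : ℕ} (hn : 1 ≤ n)
    (hP : P.natDegree ≤ n) {M : ℝ} (hM : ∀ x ∈ Set.Icc (-1 : ℝ) 1, |P.eval x| ≤ M) (k : ℕ) {x : ℝ}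
    (hx : x ∈ Set.Ioo (-1 : ℝ) 1) :
    |(derivative^[k] P).eval x| * Real.sqrt (1 - x ^ 2) ^ k
      ≤ k.factorial * Real.exp 12 * n ^ k * M := by
  have hx2 : x ^ 2 < 1 := by nlinarith [hx.1, hx.2]
  set φ := Real.sqrt (1 - x ^ 2) with hφ
  have hφ0 : 0 < φ := Real.sqrt_pos.mpr (by linarith)
  have hn0 : (0 : ℝ) < n := by exact_mod_cast hn
  have hn1 : (1 : ℝ) ≤ n := by exact_mod_cast hn
  have hM0 : 0 ≤ M := (abs_nonneg _).trans (hM 0 (by simp))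
  set PC : ℂ[X] := P.map (algebraMap ℝ ℂ) with hPC
  have hPCd : PC.natDegree ≤ n := natDegree_map_le.trans hP
  have hev : ∀ (Q : ℝ[X]) (y : ℝ), (Q.map (algebraMap ℝ ℂ)).eval (y : ℂ) = ((Q.eval y : ℝ) : ℂ) := by
    intro Q y
    exact eval_map_apply (algebraMap ℝ ℂ) y
  have hMC : ∀ y : ℝ, y ∈ Set.Icc (-1 : ℝ) 1 → ‖PC.eval (y : ℂ)‖ ≤ M := by
    intro y hy
    rw [hPC, hev, Complex.norm_real]
    exact hM y hy
  have hR : 0 < φ / n := by positivity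
  have hsphere : ∀ z ∈ Metric.sphere (x : ℂ) (φ / n), ‖PC.eval z‖ ≤ Real.exp 12 * M := by
    intro z hz
    obtain ⟨w, hw0, hw1, rfl⟩ := Complex.exists_joukowski_preimage z
    have hbound := norm_pow_mul_eval_joukowski_le hPCd hMC hw0 hw1
    have hell := Complex.norm_sub_one_add_norm_add_one_le (x := x) (h := 1 / n) hx2.le
      (by positivity) (by rw [div_le_one hn0]; exact hn1)
      (z := (w + w⁻¹) / 2) (by rw [mem_sphere_iff_norm.mp hz, ← hφ]; exact le_of_eq (by ring))
    rw [Complex.norm_sub_one_add_norm_add_one_joukowski hw0] at hell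
    have ht : 0 < ‖w‖ := norm_pos_iff.mpr hw0
    set ρ := ‖w‖⁻¹ with hρ
    have hρ0 : 0 < ρ := inv_pos.mpr ht
    have hwρ : ‖w‖ * ρ = 1 := mul_inv_cancel₀ ht.ne'
    -- The ellipse bound reads `(ρ - 1)² ≤ 11h²ρ` with `h = 1/n ≤ 1`, which fails once `ρ - 1 >
    -- 12h`.
    have hρle : ρ ≤ 1 + 12 * (1 / n) := by
      by_contra hcon
      push Not at hcon
      set h : ℝ := 1 / n with hh
      have hh0 : 0 < h := by positivity
      have hh1 : h ≤ 1 := by rw [hh, div_le_one hn0]; exact hn1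
      have h5 : (ρ - 1) ^ 2 ≤ 11 * h ^ 2 * ρ := by
        have := mul_le_mul_of_nonneg_right hell hρ0.le
        nlinarith
      nlinarith [mul_pos hh0 hh0, mul_pos hh0 (by linarith : 0 < ρ - 1)]
    have hρn : ρ ^ n ≤ Real.exp 12 := by
      calc ρ ^ n ≤ Real.exp (12 * (1 / n)) ^ n :=
            pow_le_pow_left₀ hρ0.le (hρle.trans (by
              rw [add_comm]; exact Real.add_one_le_exp _)) n
        _ = Real.exp 12 := by
            rw [← Real.exp_nat_mul]
            congr 1
            field_simp
    calc ‖PC.eval ((w + w⁻¹) / 2)‖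
        = ρ ^ n * (‖w‖ ^ n * ‖PC.eval ((w + w⁻¹) / 2)‖) := by
          rw [← mul_assoc, ← mul_pow, mul_comm ρ, hwρ, one_pow, one_mul]
      _ ≤ Real.exp 12 * M :=
          mul_le_mul hρn hbound (by positivity) (Real.exp_pos _).le
  have hcauchy := Complex.norm_iteratedDeriv_le_of_forall_mem_sphere_norm_le k hR
    (f := fun z => PC.eval z) PC.differentiable.diffContOnCl hsphere
  have hder : iteratedDeriv k (fun z : ℂ => PC.eval z) (x : ℂ)
      = (((derivative^[k] P).eval x : ℝ) : ℂ) := by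
    rw [iteratedDeriv_eval_eq, hPC, iterate_derivative_map]
    exact hev _ x
  rw [hder, Complex.norm_real, Real.norm_eq_abs] at hcauchy
  calc _ ≤ (k.factorial * (Real.exp 12 * M) / (φ / n) ^ k) * φ ^ k :=
        mul_le_mul_of_nonneg_right hcauchy (by positivity)
    _ = _ := by
        rw [div_pow]
        field_simp

/-! ### Differentiating limits of polynomials -/

open Polynomial Filter Topology in
/-- If the derivatives of order `≤ r` of polynomials converge locally uniformly on an open set, then
the limit is `r` times continuously differentiable and its derivatives are the limits. -/
theorem contDiffOn_and_iteratedDeriv_eq_of_tendstoLocallyUniformlyOn {s : Set ℝ} (hs : IsOpen s)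
    {F : ℕ → ℝ[X]} {G : ℕ → ℝ → ℝ} {r : ℕ}
    (h : ∀ k ≤ r, TendstoLocallyUniformlyOn (fun j x => (derivative^[k] (F j)).eval x) (G k)
      atTop s) :
    ContDiffOn ℝ r (G 0) s ∧ ∀ x ∈ s, iteratedDeriv r (G 0) x = G r x := by
  have hder : ∀ k < r, ∀ x ∈ s, HasDerivAt (G k) (G (k + 1) x) x := by
    intro k hk x hx
    refine hasDerivAt_of_tendstoLocallyUniformlyOn hs (h (k + 1) hk) ?_
      (fun y hy => (h k hk.le).tendsto_at hy) hx
    refine Eventually.of_forall fun j y _ => ?_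
    rw [Function.iterate_succ_apply']
    exact Polynomial.hasDerivAt _ _
  have hcont : ∀ k ≤ r, ContinuousOn (G k) s := fun k hk =>
    (h k hk).continuousOn
      (Eventually.of_forall fun j => (Polynomial.continuous _).continuousOn).frequently
  have hit : ∀ k ≤ r, Set.EqOn (iteratedDerivWithin k (G 0) s) (G k) s := by
    intro k
    induction k with
    | zero => intro _ x _; simp
    | succ k ih =>
      intro hk x hx
      have hk' : k < r := hk
      rw [iteratedDerivWithin_succ, derivWithin_congr (ih hk'.le) (ih hk'.le hx)]
      exact (hder k hk' x hx).hasDerivWithinAt.derivWithin (hs.uniqueDiffWithinAt hx)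
  constructor
  · refine contDiffOn_of_continuousOn_differentiableOn_deriv (n := (r : ℕ∞)) ?_ ?_
    · intro m hm
      have hm : m ≤ r := by exact_mod_cast hm
      exact (hcont m hm).congr (hit m hm)
    · intro m hm
      have hm : m < r := by exact_mod_cast hm
      exact DifferentiableOn.congr
        (fun x hx => (hder m hm x hx).differentiableAt.differentiableWithinAt) (hit m hm.le)
  · intro x hx
    rw [← iteratedDerivWithin_of_isOpen hs hx, hit r le_rfl hx]

/-! ### Weighted derivatives as elements of `C` -/

theorem continuous_chebWeight : Continuous chebWeight := by
  unfold chebWeight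
  fun_prop

/-- The continuous function `P^{(k)} φ^k` on `[-1, 1]`. -/
noncomputable def weightedDeriv (k : ℕ) (P : Polynomial ℝ) : CInterval :=
  polyOn (Polynomial.derivative^[k] P) *
    (⟨fun x => chebWeight x, continuous_chebWeight.comp continuous_subtype_val⟩ : CInterval) ^ k

theorem polyOn_apply (P : Polynomial ℝ) (x : Set.Icc (-1 : ℝ) 1) : polyOn P x = P.eval (x : ℝ) :=
  rfl

theorem polyOn_sub (P Q : Polynomial ℝ) : polyOn (P - Q) = polyOn P - polyOn Q := by
  ext x
  simp [polyOn_apply]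

theorem weightedDeriv_apply (k : ℕ) (P : Polynomial ℝ) (x : Set.Icc (-1 : ℝ) 1) :
    weightedDeriv k P x = (Polynomial.derivative^[k] P).eval (x : ℝ) * chebWeight x ^ k := by
  simp [weightedDeriv, polyOn_apply]

theorem weightedDeriv_zero (P : Polynomial ℝ) : weightedDeriv 0 P = polyOn P := by
  simp [weightedDeriv]

theorem weightedDeriv_sub (k : ℕ) (P Q : Polynomial ℝ) :
    weightedDeriv k (P - Q) = weightedDeriv k P - weightedDeriv k Q := by
  simp [weightedDeriv, polyOn_sub, sub_mul]

theorem norm_weightedDeriv_le (k : ℕ) {n : ℕ} (hn : 1 ≤ n) {P : Polynomial ℝ}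
    (hP : P ∈ Polynomial.degreeLT ℝ n) :
    ‖weightedDeriv k P‖ ≤ k.factorial * Real.exp 12 * n ^ k * ‖polyOn P‖ := by
  have hdeg : P.natDegree ≤ n := Polynomial.natDegree_le_of_degree_le
    (Polynomial.mem_degreeLT.mp hP).le
  have hM : ∀ x ∈ Set.Icc (-1 : ℝ) 1, |P.eval x| ≤ ‖polyOn P‖ := fun x hx =>
    (polyOn P).norm_coe_le_norm ⟨x, hx⟩
  rw [ContinuousMap.norm_le _ (by positivity)]
  rintro ⟨x, hx⟩
  rw [weightedDeriv_apply, Real.norm_eq_abs, abs_mul,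
    abs_of_nonneg (show 0 ≤ chebWeight x ^ k from pow_nonneg (Real.sqrt_nonneg _) k)]
  by_cases hx' : x ∈ Set.Ioo (-1 : ℝ) 1
  · exact P.abs_iterate_derivative_mul_sqrt_pow_le hn hdeg hM k hx'
  -- At the endpoints `φ` vanishes, but `φ^0 = 1`, so order `0` is separate.
  · rcases k.eq_zero_or_pos with rfl | hk
    · simp only [Function.iterate_zero, id_eq, pow_zero, mul_one, Nat.factorial_zero,
        Nat.cast_one, one_mul]
      exact (hM x hx).trans (le_mul_of_one_le_left (norm_nonneg _)
        (Real.one_le_exp (by norm_num)))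
    · have : chebWeight x = 0 := by
        refine Real.sqrt_eq_zero_of_nonpos ?_
        simp only [Set.mem_Ioo, not_and_or, not_lt] at hx'
        rcases hx' with h | h <;> nlinarith
      rw [this, zero_pow hk.ne', mul_zero]
      positivity

/-! ### Dyadic approximation of functions in `W_γ` -/

/-- Near-best polynomial approximants at dyadic degrees. -/
theorem exists_norm_sub_polyOn_le_of_mem_WSpace {γ : ℝ} {f : CInterval} (hf : f ∈ WSpace γ) {η : ℝ}
    (hη : 0 < η) (j : ℕ) : ∃ Q ∈ Polynomial.degreeLT ℝ (2 ^ j),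
      ‖f - polyOn Q‖ ≤ ((gammaNorm γ f).toReal + η) * ((2 : ℝ) ^ (-γ)) ^ j := by
  have h1 : ENNReal.ofReal ((2 : ℝ) ^ ((j : ℝ) * γ) * bestApproxError (2 ^ j) f) ≤ gammaNorm γ f :=
    le_add_left (le_iSup (fun j : ℕ =>
      ENNReal.ofReal ((2 : ℝ) ^ ((j : ℝ) * γ) * bestApproxError (2 ^ j) f)) j)
  have h2 := (ENNReal.ofReal_le_iff_le_toReal (ne_of_lt hf)).mp h1
  have h3 : ((2 : ℝ) ^ (-γ)) ^ j = ((2 : ℝ) ^ ((j : ℝ) * γ))⁻¹ := by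
    rw [← Real.rpow_natCast, ← Real.rpow_mul zero_le_two, ← Real.rpow_neg zero_le_two]
    congr 1
    ring
  -- The slack `η` makes this strict, so no minimiser of the infimum is needed.
  have h4 : bestApproxError (2 ^ j) f
      < ((gammaNorm γ f).toReal + η) * ((2 : ℝ) ^ (-γ)) ^ j := by
    rw [h3, ← div_eq_mul_inv, lt_div_iff₀ (by positivity), mul_comm]
    linarith
  obtain ⟨Q, hQ⟩ := exists_lt_of_ciInf_lt h4
  exact ⟨Q, Q.2, hQ.le⟩

open Filter Topology in
/-- Convergence of `Q_j^{(k)} φ^k` in `C` implies locally uniform convergence of `Q_j^{(k)}` on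
`(-1, 1)`. -/
theorem tendstoLocallyUniformlyOn_of_tendsto_weightedDeriv {k : ℕ} {Q : ℕ → Polynomial ℝ}
    {g : CInterval} (h : Tendsto (fun j => weightedDeriv k (Q j)) atTop (𝓝 g)) :
    TendstoLocallyUniformlyOn (fun j x => (Polynomial.derivative^[k] (Q j)).eval x)
      (fun x => toRealFun g x / chebWeight x ^ k) atTop (Set.Ioo (-1) 1) := by
  rw [Metric.tendstoLocallyUniformlyOn_iff]
  intro ε hε x hx
  have hpos : ∀ y ∈ Set.Ioo (-1 : ℝ) 1, 0 < chebWeight y ^ k := fun y hy =>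
    pow_pos (Real.sqrt_pos.mpr (by nlinarith [hy.1, hy.2])) k
  -- Near `x` the weight stays above `δ`, so dividing by it preserves uniform convergence.
  set δ := chebWeight x ^ k / 2 with hδ
  have hδ0 : 0 < δ := half_pos (hpos x hx)
  have hδx : δ < chebWeight x ^ k := half_lt_self (hpos x hx)
  have hnear : ∀ᶠ y in 𝓝[Set.Ioo (-1) 1] x, δ < chebWeight y ^ k :=
    (continuous_chebWeight.pow k).continuousAt.continuousWithinAt.eventually (lt_mem_nhds hδx)
  refine ⟨{y | δ < chebWeight y ^ k} ∩ Set.Ioo (-1) 1, inter_mem hnear self_mem_nhdsWithin, ?_⟩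
  filter_upwards [(Metric.tendsto_nhds.mp h) (ε * δ) (by positivity)] with j hj y hy
  obtain ⟨hyδ, hy1⟩ := hy
  have hyδ : δ < chebWeight y ^ k := hyδ
  have hmem : y ∈ Set.Icc (-1 : ℝ) 1 := Set.Ioo_subset_Icc_self hy1
  have hy0 := hpos y hy1
  have h1 : dist (weightedDeriv k (Q j) ⟨y, hmem⟩) (g ⟨y, hmem⟩) < ε * δ :=
    (ContinuousMap.dist_apply_le_dist _).trans_lt hj
  rw [weightedDeriv_apply, dist_comm, Real.dist_eq] at h1
  have h2 : toRealFun g y = g ⟨y, hmem⟩ := Set.IccExtend_of_mem _ _ hmem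
  rw [h2, Real.dist_eq]
  have h3 : |g ⟨y, hmem⟩ / chebWeight y ^ k - (Polynomial.derivative^[k] (Q j)).eval y|
      * chebWeight y ^ k < ε * δ := by
    rw [← abs_of_pos hy0, ← abs_mul, abs_of_pos hy0, sub_mul, div_mul_cancel₀ _ hy0.ne']
    exact h1
  exact lt_of_mul_lt_mul_right (h3.trans (mul_lt_mul_of_pos_left hyδ hε)) hy0.le

open Filter Topology in
/-- The `r`-th derivative of `f ∈ W_γ`, weighted by `φ^r`, is a continuous function which is
approximated by the weighted derivatives of near-best polynomial approximants. -/
theorem exists_weighted_iteratedDeriv {r : ℕ} {γ : ℝ} (hγ : (r : ℝ) < γ) {f : CInterval} {K : ℝ}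
    {Q : ℕ → Polynomial ℝ} (hQ : ∀ j, Q j ∈ Polynomial.degreeLT ℝ (2 ^ j))
    (hfQ : ∀ j, ‖f - polyOn (Q j)‖ ≤ K * ((2 : ℝ) ^ (-γ)) ^ j) :
    ContDiffOn ℝ (r : ℕ) (toRealFun f) (Set.Ioo (-1 : ℝ) 1) ∧
    ∃ G : CInterval,
      (∀ x : Set.Icc (-1 : ℝ) 1, -1 < (x : ℝ) → (x : ℝ) < 1 →
        G x = iteratedDeriv r (toRealFun f) x * chebWeight x ^ r) ∧
      ∀ j, ‖G - weightedDeriv r (Q j)‖ ≤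
        r.factorial * Real.exp 12 * 2 ^ r * (2 * K) * (2 ^ r * (2 : ℝ) ^ (-γ)) ^ j
          / (1 - 2 ^ r * (2 : ℝ) ^ (-γ)) := by
  set p : ℝ := (2 : ℝ) ^ (-γ) with hp
  have hp0 : 0 < p := by positivity
  have hq1 : ∀ k ≤ r, 2 ^ k * p < 1 := by
    intro k hk
    rw [hp, ← Real.rpow_natCast, ← Real.rpow_add two_pos]
    refine Real.rpow_lt_one_of_one_lt_of_neg one_lt_two ?_
    have : (k : ℝ) ≤ r := by exact_mod_cast hk
    linarith
  have hK : 0 ≤ K := by simpa using (norm_nonneg _).trans (hfQ 0)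
  have hp1 : p ≤ 1 := by simpa using (hq1 0 (Nat.zero_le r)).le
  have hstep : ∀ k j, dist (weightedDeriv k (Q j)) (weightedDeriv k (Q (j + 1)))
      ≤ k.factorial * Real.exp 12 * 2 ^ k * (2 * K) * (2 ^ k * p) ^ j := by
    intro k j
    have hmem : Q j - Q (j + 1) ∈ Polynomial.degreeLT ℝ (2 ^ (j + 1)) :=
      Submodule.sub_mem _ (Polynomial.degreeLT_mono (Nat.pow_le_pow_right two_pos j.le_succ) (hQ j))
        (hQ (j + 1))
    have hsmall : ‖polyOn (Q j - Q (j + 1))‖ ≤ 2 * K * p ^ j := by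
      have e : polyOn (Q j - Q (j + 1)) = (f - polyOn (Q (j + 1))) - (f - polyOn (Q j)) := by
        rw [polyOn_sub]; abel
      have h1 : K * p ^ (j + 1) ≤ K * p ^ j :=
        mul_le_mul_of_nonneg_left (pow_le_pow_of_le_one hp0.le hp1 j.le_succ) hK
      rw [e]
      linarith [norm_sub_le (f - polyOn (Q (j + 1))) (f - polyOn (Q j)), hfQ j, hfQ (j + 1)]
    rw [dist_eq_norm, ← weightedDeriv_sub]
    refine (norm_weightedDeriv_le k Nat.one_le_two_pow hmem).trans ?_
    refine (mul_le_mul_of_nonneg_left hsmall (by positivity)).trans (le_of_eq ?_)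
    push_cast
    rw [mul_pow, ← pow_mul, ← pow_mul, Nat.add_mul, pow_add, Nat.mul_comm k j]
    ring
  -- Placing `k ≤ r` under the existential lets `choose` produce limits indexed by all `k`.
  have hlim : ∀ k, ∃ g, k ≤ r → Tendsto (fun j => weightedDeriv k (Q j)) atTop (𝓝 g) := by
    intro k
    by_cases hk : k ≤ r
    · obtain ⟨g, hg⟩ := cauchySeq_tendsto_of_complete
        (cauchySeq_of_le_geometric _ _ (hq1 k hk) (hstep k))
      exact ⟨g, fun _ => hg⟩
    · exact ⟨0, fun h => absurd h hk⟩
  choose G hG using hlim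
  have hG0 : G 0 = f := by
    refine tendsto_nhds_unique (hG 0 (Nat.zero_le r)) ?_
    simp only [weightedDeriv_zero]
    rw [tendsto_iff_norm_sub_tendsto_zero]
    refine squeeze_zero (fun _ => norm_nonneg _)
      (fun j => (norm_sub_rev _ _).trans_le (hfQ j)) ?_
    simpa using (tendsto_pow_atTop_nhds_zero_of_lt_one hp0.le
      (by simpa using hq1 0 (Nat.zero_le r))).const_mul K
  have hmain := contDiffOn_and_iteratedDeriv_eq_of_tendstoLocallyUniformlyOn isOpen_Ioo
    (F := Q) (G := fun k x => toRealFun (G k) x / chebWeight x ^ k) (r := r)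
    fun k hk => tendstoLocallyUniformlyOn_of_tendsto_weightedDeriv (hG k hk)
  simp only [hG0, pow_zero, div_one] at hmain
  refine ⟨hmain.1, G r, ?_, ?_⟩
  · intro x hx1 hx2
    have hw : 0 < chebWeight x := Real.sqrt_pos.mpr (by nlinarith)
    rw [hmain.2 x ⟨hx1, hx2⟩, div_mul_cancel₀ _ (pow_pos hw r).ne']
    exact (Set.IccExtend_val _ _ x).symm
  · intro j
    rw [norm_sub_rev, ← dist_eq_norm]
    exact dist_le_of_le_geometric_of_tendsto _ _ (hq1 r le_rfl) (hstep r) (hG r le_rfl) j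

/-! ### The estimate for an arbitrary polynomial `P` -/

theorem mainTheorem7 (r : ℕ) (hr : 1 ≤ r) (γ : ℝ) (hγ : (r : ℝ) < γ) :
    ∃ c : ℝ, 0 < c ∧
      ∀ f : CInterval, f ∈ WSpace γ →
        ContDiffOn ℝ (r : ℕ) (toRealFun f) (Set.Ioo (-1 : ℝ) 1) ∧
        ∀ n : ℕ, 1 ≤ n → ∀ P : Polynomial ℝ, P ∈ Polynomial.degreeLT ℝ n →
          ∀ ε : ℝ, 0 < ε → ‖f - polyOn P‖ ≤ ε →
            ∃ g : CInterval,
              (∀ x : Set.Icc (-1 : ℝ) 1, -1 < (x : ℝ) → (x : ℝ) < 1 →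
                g x = (iteratedDeriv r (toRealFun f) x
                    - (Polynomial.derivative^[r] P).eval (x : ℝ)) * chebWeight x ^ r) ∧
              ‖g‖ ≤ c * (n : ℝ) ^ r * (ε + (n : ℝ) ^ (-γ) * (gammaNorm γ f).toReal) := by
  set p : ℝ := (2 : ℝ) ^ (-γ) with hp
  have hp0 : 0 < p := by positivity
  have hγ0 : 0 < γ := (Nat.cast_nonneg r).trans_lt hγ
  have hq1 : 0 < 1 - 2 ^ r * p := by
    rw [sub_pos, hp, ← Real.rpow_natCast, ← Real.rpow_add two_pos]
    exact Real.rpow_lt_one_of_one_lt_of_neg one_lt_two (by linarith)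
  set B : ℝ := r.factorial * Real.exp 12 with hB
  have hB0 : 0 < B := by positivity
  -- The quotient comes from the geometric tail, the final `2` from Bernstein's inequality for `Q m
  -- - P`.
  refine ⟨B * 2 ^ r * (2 ^ r * 2 / (1 - 2 ^ r * p) + 2), by positivity, fun f hf => ?_⟩
  set M := (gammaNorm γ f).toReal with hM
  have hM0 : 0 ≤ M := ENNReal.toReal_nonneg
  refine ⟨?_, ?_⟩
  · choose Q hQ hfQ using exists_norm_sub_polyOn_le_of_mem_WSpace hf one_pos
    exact (exists_weighted_iteratedDeriv hγ hQ hfQ).1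
  intro n hn P hP ε hε hfP
  have hn0 : (0 : ℝ) < n := by exact_mod_cast hn
  -- This slack contributes at most `ε` at level `m`, since `p^m ≤ n^{-γ}`.
  choose Q hQ hfQ using exists_norm_sub_polyOn_le_of_mem_WSpace hf
    (η := ε * (n : ℝ) ^ γ) (by positivity)
  obtain ⟨-, G, hG, hGQ⟩ := exists_weighted_iteratedDeriv hγ hQ hfQ
  refine ⟨G - weightedDeriv r P, ?_, ?_⟩
  · intro x hx1 hx2
    rw [ContinuousMap.sub_apply, hG x hx1 hx2, weightedDeriv_apply]
    ring
  -- Now `n ≤ 2^m ≤ 2n`: the left bound puts `P` in the same degree class as `Q m`, the right one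
  -- keeps the Bernstein factor `O(n^r)`.
  set m := Nat.log 2 n + 1 with hm
  have hnm : n ≤ 2 ^ m := (Nat.lt_pow_succ_log_self one_lt_two n).le
  have hmn : (2 : ℝ) ^ m ≤ 2 * n := by
    have : 2 ^ m ≤ 2 * n := by
      rw [hm, pow_succ, mul_comm]
      exact Nat.mul_le_mul_left 2 (Nat.pow_log_le_self 2 (by omega))
    exact_mod_cast this
  set T := ε + (n : ℝ) ^ (-γ) * M with hT
  have hnγ : (n : ℝ) ^ γ * (n : ℝ) ^ (-γ) = 1 := by
    rw [← Real.rpow_add hn0, add_neg_cancel, Real.rpow_zero]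
  have hpm : p ^ m ≤ (n : ℝ) ^ (-γ) := by
    rw [hp, ← Real.rpow_natCast, ← Real.rpow_mul two_pos.le, mul_comm, Real.rpow_mul two_pos.le,
      Real.rpow_natCast]
    exact Real.rpow_le_rpow_of_nonpos hn0 (by exact_mod_cast hnm) (by linarith)
  have hKT : (M + ε * (n : ℝ) ^ γ) * p ^ m ≤ T := by
    refine (mul_le_mul_of_nonneg_left hpm (by positivity)).trans (le_of_eq ?_)
    rw [hT]
    linear_combination ε * hnγ
  have hT0 : 0 ≤ T := by positivity
  have hεT : ε ≤ T := le_add_of_nonneg_right (by positivity)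
  have hN : ((2 : ℝ) ^ m) ^ r ≤ 2 ^ r * n ^ r := by
    rw [← mul_pow]
    exact pow_le_pow_left₀ (by positivity) hmn r
  have hmem : Q m - P ∈ Polynomial.degreeLT ℝ (2 ^ m) :=
    Submodule.sub_mem _ (hQ m) (Polynomial.degreeLT_mono hnm hP)
  have hsmall : ‖polyOn (Q m - P)‖ ≤ 2 * T := by
    have e : polyOn (Q m - P) = (f - polyOn P) - (f - polyOn (Q m)) := by
      rw [polyOn_sub]; abel
    rw [e]
    linarith [norm_sub_le (f - polyOn P) (f - polyOn (Q m)), hfQ m]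
  have h1 : ‖weightedDeriv r (Q m - P)‖ ≤ B * (2 ^ r * n ^ r) * (2 * T) := by
    refine (norm_weightedDeriv_le r Nat.one_le_two_pow hmem).trans ?_
    push_cast
    exact mul_le_mul (mul_le_mul_of_nonneg_left hN hB0.le) hsmall (norm_nonneg _) (by positivity)
  have h2 : ‖G - weightedDeriv r (Q m)‖
      ≤ B * 2 ^ r * 2 * ((2 ^ r * n ^ r) * T) / (1 - 2 ^ r * p) := by
    refine (hGQ m).trans (div_le_div_of_nonneg_right ?_ hq1.le)
    have e : B * 2 ^ r * (2 * (M + ε * (n : ℝ) ^ γ)) * (2 ^ r * p) ^ m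
        = B * 2 ^ r * 2 * (((2 : ℝ) ^ m) ^ r * ((M + ε * (n : ℝ) ^ γ) * p ^ m)) := by
      rw [mul_pow, ← pow_mul, ← pow_mul, Nat.mul_comm r m]
      ring
    rw [e]
    exact mul_le_mul_of_nonneg_left (mul_le_mul hN hKT (by positivity) (by positivity))
      (by positivity)
  have h3 : G - weightedDeriv r P = (G - weightedDeriv r (Q m)) + weightedDeriv r (Q m - P) := by
    rw [weightedDeriv_sub]; abel
  rw [h3]
  refine (norm_add_le _ _).trans ((add_le_add h2 h1).trans (le_of_eq ?_))
  ring
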